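/- Let $\mathcal X=\{0,\dots,X-1\}$ and $\mathcal Y=\{0,\dots,Y-1\}$ be fixed finite alphabets, let $g:\mathcal X\times\mathcal X\to\mathcal Y$ be any deterministic two-user multiple-access channel with matrix $\boldsymbol G$, and let $\boldsymbol G^{\otimes n}:\mathcal X^n\times\mathcal X^n\to\mathcal Y^n$ denote its $n$-fold memoryless use (that is, $g$ applied letter by letter). For $U\in\mathbb N$ let $\mathcal U=\{0,\dots,U-1\}$ and let $\boldsymbol A_I$ be the identity target function $(u_1,u_2)\mapsto(u_1,u_2)$ on $\mathcal U\times\mathcal U$. For $\delta\ge 0$, the pair $(\boldsymbol A_I,\boldsymbol G^{\otimes n})$ is called $\delta$-feasible if there are encoders $f_1,f_2:\mathcal U\to\mathcal X^n$ and a decoder $\phi:\mathcal Y^n\to\mathcal U\times\mathcal U$ such that, for independent messages $\mathsf u_1,\mathsf u_2$ uniformly distributed on $\mathcal U$, $$\mathbb P\bigl(\phi(\boldsymbol G^{\otimes n}(f_1(\mathsf u_1),f_2(\mathsf u_2)))\neq(\mathsf u_1,\mathsf u_2)\bigr)\le\delta .$$ **Theorem.** Fix a constant $\delta>0$ independent of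 $U$ and a joint distribution of discrete random variables $(\mathsf q,\mathsf x_1,\mathsf x_2,\mathsf y)$ of the form $p(q)\,p(x_1|q)\,p(x_2|q)\,p(y|x_1,x_2)$, where $\mathsf x_1,\mathsf x_2$ take values in $\mathcal X$ and $p(y|x_1,x_2)$ is specified by the channel, i.e. $\mathsf y=g(\mathsf x_1,\mathsf x_2)$. Let $H(\cdot\,|\,\cdot)$ be conditional entropy in bits and let $n:\mathbb N\to\mathbb N$ satisfy $$U^2\mathrel{\dot<}2^{n(U)H(\mathsf y|\mathsf q)},\qquad U\mathrel{\dot<}2^{n(U)H(\mathsf y|\mathsf x_1,\mathsf q)},\qquad U\mathrel{\dot<}2^{n(U)H(\mathsf y|\mathsf x_2,\mathsf q)},$$ where $U^a\mathrel{\dot<}Z(U)$ means $\liminf_{U\to\infty}\frac{\log Z(U)}{\log U}>a$ (the value $+\infty$ being allowed). Then $(\boldsymbol A_I,\boldsymbol G^{\otimes n(U)})$ is $\delta$-feasible for all sufficiently large $U$. -/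

import Mathlib

namespace MACComputation

/-- A deterministic two-user multiple-access channel (MAC), given by its channel function. -/
abbrev Channel (X₁ X₂ Y : Type*) := X₁ → X₂ → Y

/-- A target function of the two user messages. -/
abbrev Target (U₁ U₂ W : Type*) := U₁ → U₂ → W

/-- The `n`-fold (memoryless) use of a channel, acting letter by letter on input sequences. -/
def Channel.nfold {X₁ X₂ Y : Type*} (G : Channel X₁ X₂ Y) (n : ℕ) :
    Channel (Fin n → X₁) (Fin n → X₂) (Fin n → Y) :=
  fun x₁ x₂ i => G (x₁ i) (x₂ i)

/-- The identity target function on pairs of messages. -/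
def identityTarget (U : ℕ) : Target (Fin U) (Fin U) (Fin U × Fin U) :=
  fun u₁ u₂ => (u₁, u₂)

open Classical in
/-- The probability that the decoder output differs from the target value, when the two messages
are independent and uniformly distributed. -/
noncomputable def errorProb {U₁ U₂ X₁ X₂ Y W : Type*} [Fintype U₁] [Fintype U₂]
    (A : Target U₁ U₂ W) (G : Channel X₁ X₂ Y) (f₁ : U₁ → X₁) (f₂ : U₂ → X₂) (φ : Y → W) : ℝ :=
  ((Finset.univ.filter fun u : U₁ × U₂ => A u.1 u.2 ≠ φ (G (f₁ u.1) (f₂ u.2))).card : ℝ) /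
    ((Fintype.card U₁ : ℝ) * (Fintype.card U₂ : ℝ))

/-- `(A, G)` is `δ`-feasible: some encoders and decoder compute the target function `A` over the
channel `G` with probability of error at most `δ`. -/
def Feasible {U₁ U₂ X₁ X₂ Y W : Type*} [Fintype U₁] [Fintype U₂]
    (δ : ℝ) (A : Target U₁ U₂ W) (G : Channel X₁ X₂ Y) : Prop :=
  ∃ (f₁ : U₁ → X₁) (f₂ : U₂ → X₂) (φ : Y → W), errorProb A G f₁ f₂ φ ≤ δ

/-- The entropy, in bits, of a probability vector on a finite alphabet. -/
noncomputable def entropy {Y : Type*} [Fintype Y] (v : Y → ℝ) : ℝ :=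
  ∑ y, Real.negMulLog (v y) / Real.log 2

/-- The conditional entropy `H(y | z)`, in bits, of a discrete random pair `(z, y)` with joint law
`μ`: the sum over `z` of `p(z)` times the entropy of `p(y | z)`. The alphabet of `y` is finite, so
the sum always converges. -/
noncomputable def condEntropy {Z Y : Type*} [Fintype Y] (μ : PMF (Z × Y)) : ℝ :=
  ∑' z, ((μ.map Prod.fst) z).toReal *
    entropy fun y => (μ (z, y)).toReal / ((μ.map Prod.fst) z).toReal

/-- The joint law `p(q) p(x₁ | q) p(x₂ | q) p(y | x₁, x₂)` of `(q, x₁, x₂, y)`, where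
`p(y | x₁, x₂)` is specified by the channel: `y = G x₁ x₂`. -/
noncomputable def jointLaw {Q X₁ X₂ Y : Type*} (pQ : PMF Q) (p₁ : Q → PMF X₁) (p₂ : Q → PMF X₂)
    (G : Channel X₁ X₂ Y) : PMF (Q × X₁ × X₂ × Y) :=
  pQ.bind fun q => (p₁ q).bind fun x₁ => (p₂ q).bind fun x₂ => PMF.pure (q, x₁, x₂, G x₁ x₂)

/-- `H(y | q)` for a joint law of `(q, x₁, x₂, y)`. -/
noncomputable def entropyYGivenQ {Q X₁ X₂ Y : Type*} [Fintype Y] (μ : PMF (Q × X₁ × X₂ × Y)) : ℝ :=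
  condEntropy (μ.map fun t => (t.1, t.2.2.2))

/-- `H(y | x₁, q)` for a joint law of `(q, x₁, x₂, y)`. -/
noncomputable def entropyYGivenX₁Q {Q X₁ X₂ Y : Type*} [Fintype Y]
    (μ : PMF (Q × X₁ × X₂ × Y)) : ℝ :=
  condEntropy (μ.map fun t => ((t.2.1, t.1), t.2.2.2))

/-- `H(y | x₂, q)` for a joint law of `(q, x₁, x₂, y)`. -/
noncomputable def entropyYGivenX₂Q {Q X₁ X₂ Y : Type*} [Fintype Y]
    (μ : PMF (Q × X₁ × X₂ × Y)) : ℝ :=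
  condEntropy (μ.map fun t => ((t.2.2.1, t.1), t.2.2.2))

/-- The strict exponent relation between `U ^ a` and `Z U`, that is,
`a < liminf log (Z U) / log U` as `U → ∞`. The limit inferior is taken in the extended reals, so
that it may be `+∞`. -/
def PowDotLT (a : ℝ) (Z : ℕ → ℝ) : Prop :=
  (a : EReal) < Filter.liminf
    (fun U : ℕ => ((Real.logb 2 (Z U) / Real.logb 2 (U : ℝ) : ℝ) : EReal)) Filter.atTop

end MACComputation

/-! The proof is random coding with a Gallager-type exponent instead of typical sequences. The
channel is deterministic, so a decoder that returns any message pair consistent with the output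
fails only if another pair has the same output (`exists_errorProb_le`). Such a pair differs from the
true one in both messages or in exactly one, which gives three collision events and matches the
three rate conditions.

Over independent codebooks with N competitors, the chance of a collision at output y is at most
min(1, N P(y)) ≤ (N P(y))^s for 0 < s ≤ 1, where P is the relevant output law (`avg_collision_both`,
`avg_collision_single`). The average of P(y)^s is multiplicative over channel uses (`rhoSum_pi`,
`rhoSum_prodWeight_pi`), and for one letter it is at most 1 - s H ln 2 + O(s²) (`rhoSum_le`).

Time sharing needs no random sequence in the code: the three error terms are products over letters,
so one fixed sequence makes their weighted sum at most its mean over independent draws of q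
(`exists_timeSharing`). Each term is then at most U^(as) exp(-n s (H ln 2 - sK)) with a = 2, 1, 1.
The rate condition gives n H ln 2 > b ln U eventually for some b > a, so a small fixed s sends the
term to 0 (`exists_exponent`). -/

namespace MACComputation

/-! ### Finite weighted averages -/

section Avg

variable {A B ι : Type*} [Fintype A] [Fintype B]

/-- The average of `F` with respect to the weights `μ`. -/
noncomputable def avg (μ F : A → ℝ) : ℝ := ∑ a, μ a * F a

/-- `μ` is a probability vector. -/
structure IsProb (μ : A → ℝ) : Prop where
  nonneg : ∀ a, 0 ≤ μ a
  sum_eq_one : ∑ a, μ a = 1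

/-- The product of a family of weight vectors. -/
noncomputable def piWeight [Fintype ι] (μ : ι → A → ℝ) (x : ι → A) : ℝ := ∏ i, μ i (x i)

/-- The product of two weight vectors. -/
def prodWeight (μ : A → ℝ) (ν : B → ℝ) (p : A × B) : ℝ := μ p.1 * ν p.2

lemma avg_add (μ F F' : A → ℝ) : avg μ (fun a => F a + F' a) = avg μ F + avg μ F' := by
  simp [avg, mul_add, Finset.sum_add_distrib]

lemma avg_mul_left (μ F : A → ℝ) (c : ℝ) : avg μ (fun a => c * F a) = c * avg μ F := by
  simp only [avg, Finset.mul_sum]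
  exact Finset.sum_congr rfl fun a _ => by ring

lemma avg_mul_right (μ F : A → ℝ) (c : ℝ) : avg μ (fun a => F a * c) = avg μ F * c := by
  simp only [avg, Finset.sum_mul]
  exact Finset.sum_congr rfl fun a _ => by ring

lemma avg_sum {κ : Type*} (μ : A → ℝ) (t : Finset κ) (F : κ → A → ℝ) :
    avg μ (fun a => ∑ k ∈ t, F k a) = ∑ k ∈ t, avg μ (F k) := by
  simp only [avg, Finset.mul_sum]
  exact Finset.sum_comm

lemma IsProb.avg_const {μ : A → ℝ} (h : IsProb μ) (c : ℝ) : avg μ (fun _ => c) = c := by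
  simp [avg, ← Finset.sum_mul, h.sum_eq_one]

lemma IsProb.avg_mono {μ F F' : A → ℝ} (h : IsProb μ) (hF : ∀ a, F a ≤ F' a) :
    avg μ F ≤ avg μ F' :=
  Finset.sum_le_sum fun a _ => mul_le_mul_of_nonneg_left (hF a) (h.nonneg a)

lemma IsProb.avg_nonneg {μ F : A → ℝ} (h : IsProb μ) (hF : ∀ a, 0 ≤ F a) : 0 ≤ avg μ F :=
  Finset.sum_nonneg fun a _ => mul_nonneg (h.nonneg a) (hF a)

lemma IsProb.avg_le {μ F : A → ℝ} {c : ℝ} (h : IsProb μ) (hF : ∀ a, F a ≤ c) : avg μ F ≤ c :=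
  (h.avg_mono hF).trans_eq (h.avg_const c)

lemma avg_comm (μ : A → ℝ) (ν : B → ℝ) (F : A → B → ℝ) :
    avg μ (fun a => avg ν (F a)) = avg ν (fun b => avg μ fun a => F a b) := by
  simp only [avg, Finset.mul_sum]
  rw [Finset.sum_comm]
  exact Finset.sum_congr rfl fun b _ => Finset.sum_congr rfl fun a _ => by ring

lemma IsProb.exists_le {μ F : A → ℝ} {c : ℝ} (h : IsProb μ) (hF : avg μ F ≤ c) :
    ∃ a, F a ≤ c := by
  by_contra! hc
  obtain ⟨a, ha⟩ : ∃ a, 0 < μ a := by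
    by_contra! hn
    have := Finset.sum_nonpos fun a (_ : a ∈ Finset.univ) => hn a
    rw [h.sum_eq_one] at this
    linarith
  have : avg μ (fun _ => c) < avg μ F :=
    Finset.sum_lt_sum (fun a _ => mul_le_mul_of_nonneg_left (hc a).le (h.nonneg a))
      ⟨a, Finset.mem_univ _, mul_lt_mul_of_pos_left (hc a) ha⟩
  rw [h.avg_const] at this
  linarith

lemma avg_prodWeight (μ : A → ℝ) (ν : B → ℝ) (F : A × B → ℝ) :
    avg (prodWeight μ ν) F = avg μ fun a => avg ν fun b => F (a, b) := by
  simp only [avg, prodWeight, Fintype.sum_prod_type, Finset.mul_sum, mul_assoc]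

lemma IsProb.prodWeight {μ : A → ℝ} {ν : B → ℝ} (hμ : IsProb μ) (hν : IsProb ν) :
    IsProb (prodWeight μ ν) where
  nonneg p := mul_nonneg (hμ.nonneg _) (hν.nonneg _)
  sum_eq_one := by
    have := avg_prodWeight μ ν fun _ => 1
    rw [hν.avg_const, hμ.avg_const] at this
    simpa [avg] using this

variable [Fintype ι] [DecidableEq ι]

lemma avg_piWeight_prod (μ : ι → A → ℝ) (F : ι → A → ℝ) :
    avg (piWeight μ) (fun x => ∏ i, F i (x i)) = ∏ i, avg (μ i) (F i) := by
  simp only [avg, piWeight, ← Finset.prod_mul_distrib]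
  rw [Finset.prod_univ_sum, Fintype.piFinset_univ]

lemma IsProb.piWeight {μ : ι → A → ℝ} (h : ∀ i, IsProb (μ i)) : IsProb (piWeight μ) where
  nonneg x := Finset.prod_nonneg fun i _ => (h i).nonneg _
  sum_eq_one := by
    have := avg_piWeight_prod μ fun _ _ => 1
    simp only [(h _).avg_const, Finset.prod_const_one] at this
    simpa [avg] using this

lemma avg_piWeight_eval {μ : ι → A → ℝ} (h : ∀ i, IsProb (μ i)) (i : ι) (g : A → ℝ) :
    avg (piWeight μ) (fun x => g (x i)) = avg (μ i) g := by
  -- Factors equal to 1 integrate out, leaving the marginal at `i`.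
  have := avg_piWeight_prod μ fun j a => if j = i then g a else 1
  simp only [Finset.prod_ite_eq', Finset.mem_univ, if_true] at this
  rw [this, Finset.prod_eq_single i]
  · simp
  · intro j _ hj
    simp [hj, (h j).avg_const]
  · simp

lemma avg_piWeight_eval_mul {μ : ι → A → ℝ} (h : ∀ i, IsProb (μ i)) {i j : ι} (hij : i ≠ j)
    (g k : A → ℝ) :
    avg (piWeight μ) (fun x => g (x i) * k (x j)) = avg (μ i) g * avg (μ j) k := by
  have := avg_piWeight_prod μ fun l a => (if l = i then g a else 1) * (if l = j then k a else 1)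
  simp only [Finset.prod_mul_distrib, Finset.prod_ite_eq', Finset.mem_univ, if_true] at this
  rw [this]
  have key : ∀ l, avg (μ l) (fun a => (if l = i then g a else 1) * (if l = j then k a else 1)) =
      (if l = i then avg (μ l) g else 1) * (if l = j then avg (μ l) k else 1) := by
    intro l
    by_cases hi : l = i
    · have hj : l ≠ j := fun hj => hij (hi.symm.trans hj)
      simp only [hi, if_true, if_neg hij, mul_one]
    · by_cases hj : l = j
      · simp [hij.symm, hj]
      · simp [hi, hj, (h l).avg_const]
  simp only [key, Finset.prod_mul_distrib, Finset.prod_ite_eq', Finset.mem_univ, if_true]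

-- Expanding `g` in indicators of its first argument reduces this to products of one-coordinate
-- functions. Pairwise independence of codewords is all that the union bounds below use.
open Classical in
lemma avg_piWeight_pair {μ : ι → A → ℝ} (h : ∀ i, IsProb (μ i)) {i j : ι} (hij : i ≠ j)
    (g : A → A → ℝ) :
    avg (piWeight μ) (fun x => g (x i) (x j)) = avg (μ i) fun a => avg (μ j) (g a) := by
  have h1 : ∀ x : ι → A, g (x i) (x j) = ∑ a, (if x i = a then 1 else 0) * g a (x j) := by
    intro x
    simp
  simp only [h1]
  rw [avg_sum]
  have h2 : ∀ a : A, avg (piWeight μ) (fun x => (if x i = a then 1 else 0) * g a (x j)) =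
      μ i a * avg (μ j) (g a) := by
    intro a
    rw [avg_piWeight_eval_mul h hij (fun b => if b = a then 1 else 0) (g a)]
    congr 1
    simp [avg]
  simp only [h2]
  rfl

end Avg

/-! ### One-shot random coding -/

section OneShot

variable {A B C : Type*}

open Classical in
/-- The indicator of a proposition, as a real number. -/
noncomputable def ind (P : Prop) : ℝ := if P then 1 else 0

lemma ind_of {P : Prop} (h : P) : ind P = 1 := if_pos h

lemma ind_of_not {P : Prop} (h : ¬P) : ind P = 0 := if_neg h

lemma ind_nonneg (P : Prop) : 0 ≤ ind P := by
  unfold ind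
  split_ifs <;> norm_num

lemma ind_le_one (P : Prop) : ind P ≤ 1 := by
  unfold ind
  split_ifs <;> norm_num

lemma ind_forall {ι : Type*} [Fintype ι] (P : ι → Prop) : ind (∀ i, P i) = ∏ i, ind (P i) := by
  classical
  simp [ind, Finset.prod_ite_zero]

open Classical in
/-- If `φ` picks a message pair consistent with the output whenever there is one, then an error
at a message pair requires a collision. -/
lemma exists_errorProb_le {U : ℕ} (hU : 0 < U) (G : A → B → C) (f₁ : Fin U → A)
    (f₂ : Fin U → B) :
    ∃ φ : C → Fin U × Fin U, errorProb (identityTarget U) G f₁ f₂ φ ≤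
      (∑ u : Fin U × Fin U,
        (ind (∃ u' v', u' ≠ u.1 ∧ v' ≠ u.2 ∧ G (f₁ u') (f₂ v') = G (f₁ u.1) (f₂ u.2)) +
          (ind (∃ v', v' ≠ u.2 ∧ G (f₁ u.1) (f₂ v') = G (f₁ u.1) (f₂ u.2))) +
          (ind (∃ u', u' ≠ u.1 ∧ G (f₁ u') (f₂ u.2) = G (f₁ u.1) (f₂ u.2))))) /
      ((U : ℝ) * U) := by
  -- The default pair only fills in outputs that no message pair produces.
  refine ⟨fun y => if h : ∃ u : Fin U × Fin U, G (f₁ u.1) (f₂ u.2) = y then h.choose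
    else (⟨0, hU⟩, ⟨0, hU⟩), ?_⟩
  simp only [errorProb, Fintype.card_fin]
  gcongr
  rw [Finset.card_filter, Nat.cast_sum]
  refine Finset.sum_le_sum fun u _ => ?_
  have hn := ind_nonneg
  by_cases he : identityTarget U u.1 u.2 = if h : ∃ w : Fin U × Fin U,
      G (f₁ w.1) (f₂ w.2) = G (f₁ u.1) (f₂ u.2) then h.choose else (⟨0, hU⟩, ⟨0, hU⟩)
  · rw [if_neg (not_not.2 he), Nat.cast_zero]
    exact add_nonneg (add_nonneg (hn _) (hn _)) (hn _)
  rw [if_pos he, Nat.cast_one]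
  have hex : ∃ w : Fin U × Fin U, G (f₁ w.1) (f₂ w.2) = G (f₁ u.1) (f₂ u.2) := ⟨u, rfl⟩
  rw [dif_pos hex] at he
  have hw := hex.choose_spec
  set w := hex.choose
  have hne : u ≠ w := he
  by_cases h1 : w.1 = u.1
  · have h2 : w.2 ≠ u.2 := fun h2 => hne (Prod.ext h1.symm h2.symm)
    rw [h1] at hw
    rw [ind_of (⟨w.2, h2, hw⟩ : ∃ v', v' ≠ u.2 ∧ G (f₁ u.1) (f₂ v') = G (f₁ u.1) (f₂ u.2))]
    linarith [hn (∃ u' v', u' ≠ u.1 ∧ v' ≠ u.2 ∧ G (f₁ u') (f₂ v') = G (f₁ u.1) (f₂ u.2)),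
      hn (∃ u', u' ≠ u.1 ∧ G (f₁ u') (f₂ u.2) = G (f₁ u.1) (f₂ u.2))]
  by_cases h2 : w.2 = u.2
  · rw [h2] at hw
    rw [ind_of (⟨w.1, h1, hw⟩ : ∃ u', u' ≠ u.1 ∧ G (f₁ u') (f₂ u.2) = G (f₁ u.1) (f₂ u.2))]
    linarith [hn (∃ u' v', u' ≠ u.1 ∧ v' ≠ u.2 ∧ G (f₁ u') (f₂ v') = G (f₁ u.1) (f₂ u.2)),
      hn (∃ v', v' ≠ u.2 ∧ G (f₁ u.1) (f₂ v') = G (f₁ u.1) (f₂ u.2))]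
  · rw [ind_of (⟨w.1, w.2, h1, h2, hw⟩ : ∃ u' v', u' ≠ u.1 ∧ v' ≠ u.2 ∧
      G (f₁ u') (f₂ v') = G (f₁ u.1) (f₂ u.2))]
    linarith [hn (∃ v', v' ≠ u.2 ∧ G (f₁ u.1) (f₂ v') = G (f₁ u.1) (f₂ u.2)),
      hn (∃ u', u' ≠ u.1 ∧ G (f₁ u') (f₂ u.2) = G (f₁ u.1) (f₂ u.2))]

variable [Fintype A] [Fintype B]

/-- The probability that `g a = y` when `a` has law `μ`. -/
noncomputable def outProb (μ : A → ℝ) (g : A → C) (y : C) : ℝ :=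
  avg μ fun a => ind (g a = y)

lemma outProb_nonneg {μ : A → ℝ} (h : IsProb μ) (g : A → C) (y : C) : 0 ≤ outProb μ g y :=
  h.avg_nonneg fun _ => ind_nonneg _

lemma outProb_le_one {μ : A → ℝ} (h : IsProb μ) (g : A → C) (y : C) : outProb μ g y ≤ 1 :=
  h.avg_le fun _ => ind_le_one _

/-- This encodes min(1, x) ≤ x^s: the pair selects either the trivial bound 1 or the union bound x.
Having the choice as coefficients lets it depend on the output and still be averaged linearly. -/
lemma exists_truncation {x s : ℝ} (hx : 0 ≤ x) (hs : 0 < s) (hs1 : s ≤ 1) :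
    ∃ p : ℝ × ℝ, 0 ≤ p.1 ∧ 0 ≤ p.2 ∧ 1 ≤ p.1 + p.2 ∧ p.1 + p.2 * x ≤ x ^ s := by
  by_cases h : 1 ≤ x
  · exact ⟨(1, 0), by norm_num, by norm_num, by norm_num, by simpa using Real.one_le_rpow h hs.le⟩
  · refine ⟨(0, 1), by norm_num, by norm_num, by norm_num, ?_⟩
    simpa using Real.rpow_le_rpow_of_exponent_ge' hx (not_le.mp h).le hs.le hs1

/-- The average over random codebooks of the indicator that the codeword pair of `(u, v)` collides
with a codeword pair `(u', v')`, `u' ≠ u`, `v' ≠ v`. -/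
lemma avg_collision_both {V : Type*} [Fintype V] [DecidableEq V] {μ : A → ℝ} {ν : B → ℝ}
    (hμ : IsProb μ) (hν : IsProb ν) (G : A → B → C) (u v : V) {s : ℝ} (hs : 0 < s) (hs1 : s ≤ 1) :
    (avg (piWeight fun _ : V => μ) fun f₁ => avg (piWeight fun _ : V => ν) fun f₂ =>
      ind (∃ u' v', u' ≠ u ∧ v' ≠ v ∧ G (f₁ u') (f₂ v') = G (f₁ u) (f₂ v))) ≤
    ((Fintype.card V : ℝ) ^ 2) ^ s *
      avg μ fun a => avg ν fun b =>
        (outProb (prodWeight μ ν) (fun p => G p.1 p.2) (G a b)) ^ s := by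
  have hp := hμ.prodWeight hν
  set r := outProb (prodWeight μ ν) (fun p => G p.1 p.2) with hr
  have hr0 : ∀ y, 0 ≤ r y := outProb_nonneg hp _
  set N : ℝ := ((Fintype.card V : ℕ) : ℝ) with hN
  have hN0 : 0 ≤ N := Nat.cast_nonneg _
  -- `N ^ 2` bounds the number of competing pairs, and `r y` is the chance that one independent
  -- competitor produces `y`.
  have hx : ∀ y, 0 ≤ N ^ 2 * r y := fun y => mul_nonneg (sq_nonneg _) (hr0 y)
  choose p hp1 hp2 hp3 hp4 using fun y => exists_truncation (hx y) hs hs1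
  have hW1 : IsProb (piWeight fun _ : V => μ) := IsProb.piWeight fun _ => hμ
  have hW2 : IsProb (piWeight fun _ : V => ν) := IsProb.piWeight fun _ => hν
  calc _ ≤ avg (piWeight fun _ : V => μ) fun f₁ => avg (piWeight fun _ : V => ν) fun f₂ =>
        (p (G (f₁ u) (f₂ v))).1 + ∑ u' ∈ Finset.univ.erase u, ∑ v' ∈ Finset.univ.erase v,
          (p (G (f₁ u) (f₂ v))).2 *
            ind (G (f₁ u') (f₂ v') = G (f₁ u) (f₂ v)) := by
        refine hW1.avg_mono fun f₁ => hW2.avg_mono fun f₂ => ?_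
        have hnn : ∀ u' v' : V, (0 : ℝ) ≤ (p (G (f₁ u) (f₂ v))).2 *
            ind (G (f₁ u') (f₂ v') = G (f₁ u) (f₂ v)) := fun u' v' =>
          mul_nonneg (hp2 _) (ind_nonneg _)
        by_cases hc : ∃ u' v', u' ≠ u ∧ v' ≠ v ∧ G (f₁ u') (f₂ v') = G (f₁ u) (f₂ v)
        · rw [ind_of hc]
          obtain ⟨u', v', hu, hv, hG⟩ := hc
          refine (hp3 (G (f₁ u) (f₂ v))).trans ?_
          gcongr
          refine le_trans ?_ (Finset.single_le_sum (fun u' _ => Finset.sum_nonneg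
            fun v' _ => hnn u' v') (Finset.mem_erase.2 ⟨hu, Finset.mem_univ _⟩))
          refine le_trans ?_ (Finset.single_le_sum (fun v' _ => hnn u' v')
            (Finset.mem_erase.2 ⟨hv, Finset.mem_univ _⟩))
          rw [ind_of hG, mul_one]
        · rw [ind_of_not hc]
          exact add_nonneg (hp1 _) (Finset.sum_nonneg fun u' _ => Finset.sum_nonneg
            fun v' _ => hnn u' v')
    _ = (avg μ fun a => avg ν fun b => (p (G a b)).1) +
        ∑ u' ∈ Finset.univ.erase u, ∑ v' ∈ Finset.univ.erase v,
          avg μ fun a => avg ν fun b => (p (G a b)).2 * r (G a b) := by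
        simp only [avg_add, avg_sum]
        congr 1
        · have e0 : ∀ f₁ : V → A, (avg (piWeight fun _ : V => ν) fun f₂ =>
              (p (G (f₁ u) (f₂ v))).1) = avg ν fun b => (p (G (f₁ u) b)).1 := fun f₁ =>
            avg_piWeight_eval (fun _ : V => hν) v fun b => (p (G (f₁ u) b)).1
          simp only [e0]
          rw [avg_piWeight_eval (fun _ : V => hμ) u fun a => avg ν fun b => (p (G a b)).1]
        · refine Finset.sum_congr rfl fun u' hu' => Finset.sum_congr rfl fun v' hv' => ?_
          have hu := (Finset.ne_of_mem_erase hu').symm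
          have hv := (Finset.ne_of_mem_erase hv').symm
          have e1 : ∀ f₁ : V → A, (avg (piWeight fun _ : V => ν) fun f₂ =>
              (p (G (f₁ u) (f₂ v))).2 *
                ind (G (f₁ u') (f₂ v') = G (f₁ u) (f₂ v))) =
              avg ν fun b => avg ν fun b' => (p (G (f₁ u) b)).2 *
                ind (G (f₁ u') b' = G (f₁ u) b) := fun f₁ =>
            avg_piWeight_pair (fun _ : V => hν) hv fun b b' => (p (G (f₁ u) b)).2 *
                ind (G (f₁ u') b' = G (f₁ u) b)
          simp only [e1]
          rw [avg_piWeight_pair (fun _ : V => hμ) hu fun a a' => avg ν fun b => avg ν fun b' =>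
            (p (G a b)).2 * ind (G a' b' = G a b)]
          congr 1
          funext a
          rw [avg_comm]
          congr 1
          funext b
          simp only [avg_mul_left]
          rw [hr, outProb, avg_prodWeight]
    _ ≤ (avg μ fun a => avg ν fun b => (p (G a b)).1) +
          N ^ 2 * avg μ fun a => avg ν fun b => (p (G a b)).2 * r (G a b) := by
        have hnn : 0 ≤ avg μ fun a => avg ν fun b => (p (G a b)).2 * r (G a b) :=
          hμ.avg_nonneg fun a => hν.avg_nonneg fun b => mul_nonneg (hp2 _) (hr0 _)
        have hc : ∀ w : V, (((Finset.univ.erase w).card : ℕ) : ℝ) ≤ N := fun w => by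
          rw [hN]
          exact_mod_cast Finset.card_le_univ _
        simp only [Finset.sum_const, nsmul_eq_mul]
        rw [← mul_assoc, sq]
        gcongr
        · exact hc u
        · exact hc v
    _ = avg μ fun a => avg ν fun b => (p (G a b)).1 + (p (G a b)).2 * (N ^ 2 * r (G a b)) := by
        simp only [← avg_mul_left, ← avg_add]
        congr 1; funext a; congr 1; funext b; ring
    _ ≤ avg μ fun a => avg ν fun b => (N ^ 2 * r (G a b)) ^ s :=
        hμ.avg_mono fun a => hν.avg_mono fun b => hp4 _
    _ = _ := by
        simp only [← avg_mul_left]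
        congr 1; funext a; congr 1; funext b
        rw [Real.mul_rpow (sq_nonneg _) (hr0 _)]

/-- The average over random codebooks of the indicator that the codeword of `v` collides with
another codeword under the map `g`. -/
lemma avg_collision_single {V : Type*} [Fintype V] [DecidableEq V] {ν : B → ℝ}
    (hν : IsProb ν) (g : B → C) (v : V) {s : ℝ} (hs : 0 < s) (hs1 : s ≤ 1) :
    (avg (piWeight fun _ : V => ν) fun f => ind (∃ v', v' ≠ v ∧ g (f v') = g (f v))) ≤
    (Fintype.card V : ℝ) ^ s * avg ν fun b => (outProb ν g (g b)) ^ s := by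
  set r := outProb ν g with hr
  have hr0 : ∀ y, 0 ≤ r y := outProb_nonneg hν _
  set N : ℝ := ((Fintype.card V : ℕ) : ℝ) with hN
  have hN0 : 0 ≤ N := Nat.cast_nonneg _
  have hx : ∀ y, 0 ≤ N * r y := fun y => mul_nonneg hN0 (hr0 y)
  choose p hp1 hp2 hp3 hp4 using fun y => exists_truncation (hx y) hs hs1
  have hW2 : IsProb (piWeight fun _ : V => ν) := IsProb.piWeight fun _ => hν
  calc _ ≤ avg (piWeight fun _ : V => ν) fun f =>
        (p (g (f v))).1 + ∑ v' ∈ Finset.univ.erase v,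
          (p (g (f v))).2 * ind (g (f v') = g (f v)) := by
        refine hW2.avg_mono fun f => ?_
        have hnn : ∀ v' : V, (0 : ℝ) ≤ (p (g (f v))).2 *
            ind (g (f v') = g (f v)) := fun v' =>
          mul_nonneg (hp2 _) (ind_nonneg _)
        by_cases hc : ∃ v', v' ≠ v ∧ g (f v') = g (f v)
        · rw [ind_of hc]
          obtain ⟨v', hv, hG⟩ := hc
          refine (hp3 (g (f v))).trans ?_
          gcongr
          refine le_trans ?_ (Finset.single_le_sum (fun v' _ => hnn v')
            (Finset.mem_erase.2 ⟨hv, Finset.mem_univ _⟩))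
          rw [ind_of hG, mul_one]
        · rw [ind_of_not hc]
          exact add_nonneg (hp1 _) (Finset.sum_nonneg fun v' _ => hnn v')
    _ = (avg ν fun b => (p (g b)).1) +
        ∑ v' ∈ Finset.univ.erase v, avg ν fun b => (p (g b)).2 * r (g b) := by
        simp only [avg_add, avg_sum]
        congr 1
        · exact avg_piWeight_eval (fun _ : V => hν) v fun b => (p (g b)).1
        · refine Finset.sum_congr rfl fun v' hv' => ?_
          have hv := (Finset.ne_of_mem_erase hv').symm
          rw [avg_piWeight_pair (fun _ : V => hν) hv fun b b' =>
            (p (g b)).2 * ind (g b' = g b)]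
          simp only [avg_mul_left]
          rfl
    _ ≤ (avg ν fun b => (p (g b)).1) + N * avg ν fun b => (p (g b)).2 * r (g b) := by
        have hnn : 0 ≤ avg ν fun b => (p (g b)).2 * r (g b) :=
          hν.avg_nonneg fun b => mul_nonneg (hp2 _) (hr0 _)
        have hc : (((Finset.univ.erase v).card : ℕ) : ℝ) ≤ N := by
          rw [hN]
          exact_mod_cast Finset.card_le_univ _
        simp only [Finset.sum_const, nsmul_eq_mul]
        gcongr
    _ = avg ν fun b => (p (g b)).1 + (p (g b)).2 * (N * r (g b)) := by
        simp only [← avg_mul_left, ← avg_add]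
        congr 1; funext b; ring
    _ ≤ avg ν fun b => (N * r (g b)) ^ s := hν.avg_mono fun b => hp4 _
    _ = _ := by
        simp only [← avg_mul_left]
        congr 1; funext b
        rw [Real.mul_rpow hN0 (hr0 _)]

/-- Random coding bound for the identity target over a deterministic channel. -/
theorem exists_code {U : ℕ} (hU : 0 < U) (G : A → B → C) {μ : A → ℝ} {ν : B → ℝ}
    (hμ : IsProb μ) (hν : IsProb ν) {s₀ s₁ s₂ : ℝ} (h₀ : 0 < s₀ ∧ s₀ ≤ 1)
    (h₁ : 0 < s₁ ∧ s₁ ≤ 1) (h₂ : 0 < s₂ ∧ s₂ ≤ 1) :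
    ∃ (f₁ : Fin U → A) (f₂ : Fin U → B) (φ : C → Fin U × Fin U),
      errorProb (identityTarget U) G f₁ f₂ φ ≤
        ((U : ℝ) ^ 2) ^ s₀ * (avg μ fun a => avg ν fun b =>
          (outProb (prodWeight μ ν) (fun p => G p.1 p.2) (G a b)) ^ s₀) +
        (U : ℝ) ^ s₁ * (avg μ fun a => avg ν fun b => (outProb ν (G a) (G a b)) ^ s₁) +
        (U : ℝ) ^ s₂ * (avg ν fun b => avg μ fun a =>
          (outProb μ (fun a => G a b) (G a b)) ^ s₂) := by
  classical
  set T := ((U : ℝ) ^ 2) ^ s₀ * (avg μ fun a => avg ν fun b =>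
          (outProb (prodWeight μ ν) (fun p => G p.1 p.2) (G a b)) ^ s₀) +
        (U : ℝ) ^ s₁ * (avg μ fun a => avg ν fun b => (outProb ν (G a) (G a b)) ^ s₁) +
        (U : ℝ) ^ s₂ * (avg ν fun b => avg μ fun a =>
          (outProb μ (fun a => G a b) (G a b)) ^ s₂) with hT
  choose φ hφ using exists_errorProb_le hU G
  have hW1 : IsProb (piWeight fun _ : Fin U => μ) := IsProb.piWeight fun _ => hμ
  have hW2 : IsProb (piWeight fun _ : Fin U => ν) := IsProb.piWeight fun _ => hν
  have hU' : (0 : ℝ) < U := Nat.cast_pos.2 hU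
  have main : (avg (piWeight fun _ : Fin U => μ) fun f₁ => avg (piWeight fun _ : Fin U => ν)
      fun f₂ => errorProb (identityTarget U) G f₁ f₂ (φ f₁ f₂)) ≤ T := by
    refine (hW1.avg_mono fun f₁ => hW2.avg_mono fun f₂ => hφ f₁ f₂).trans ?_
    simp only [div_eq_mul_inv, avg_mul_right, avg_sum]
    rw [← div_eq_mul_inv, div_le_iff₀ (by positivity)]
    refine (Finset.sum_le_card_nsmul _ _ T fun u _ => ?_).trans_eq ?_
    · rw [hT]
      simp only [avg_add]
      refine add_le_add (add_le_add ?_ ?_) ?_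
      · simpa using avg_collision_both hμ hν G u.1 u.2 h₀.1 h₀.2
      -- With the first codebook frozen, this is a collision for the single-user map `G (f₁ u.1)`.
      · refine (hW1.avg_mono fun f₁ =>
          avg_collision_single hν (G (f₁ u.1)) u.2 h₁.1 h₁.2).trans_eq ?_
        rw [avg_mul_left, Fintype.card_fin]
        rw [avg_piWeight_eval (fun _ : Fin U => hμ) u.1 fun a =>
          avg ν fun b => (outProb ν (G a) (G a b)) ^ s₁]
      · rw [avg_comm]
        refine (hW2.avg_mono fun f₂ =>
          avg_collision_single hμ (fun a => G a (f₂ u.2)) u.1 h₂.1 h₂.2).trans_eq ?_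
        rw [avg_mul_left, Fintype.card_fin]
        rw [avg_piWeight_eval (fun _ : Fin U => hν) u.2 fun b =>
          avg μ fun a => (outProb μ (fun a => G a b) (G a b)) ^ s₂]
    · simp
      ring
  obtain ⟨f₁, hf₁⟩ := hW1.exists_le main
  obtain ⟨f₂, hf₂⟩ := hW2.exists_le hf₁
  exact ⟨f₁, f₂, φ f₁ f₂, hf₂⟩

end OneShot

/-! ### The single-letter exponent -/

section Letter

variable {A B C : Type*} [Fintype A] [Fintype B]

/-- The average of `P(y)^s`, where `y = g a`, `a` has law `μ` and `P` is the law of `y`. -/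
noncomputable def rhoSum (μ : A → ℝ) (g : A → C) (s : ℝ) : ℝ :=
  avg μ fun a => outProb μ g (g a) ^ s

lemma rhoSum_nonneg {μ : A → ℝ} (h : IsProb μ) (g : A → C) (s : ℝ) : 0 ≤ rhoSum μ g s :=
  h.avg_nonneg fun _ => Real.rpow_nonneg (outProb_nonneg h _ _) _

lemma rhoSum_le_one {μ : A → ℝ} (h : IsProb μ) (g : A → C) {s : ℝ} (hs : 0 ≤ s) :
    rhoSum μ g s ≤ 1 :=
  h.avg_le fun _ => Real.rpow_le_one (outProb_nonneg h _ _) (outProb_le_one h _ _) hs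

lemma avg_comp [Fintype C] (μ : A → ℝ) (g : A → C) (k : C → ℝ) :
    avg μ (fun a => k (g a)) = ∑ y, outProb μ g y * k y := by
  classical
  have : ∀ a, k (g a) = ∑ y, ind (g a = y) * k y := fun a => by simp [ind]
  simp only [this]
  rw [avg_sum]
  exact Finset.sum_congr rfl fun y _ => avg_mul_right _ _ _

lemma sum_outProb [Fintype C] {μ : A → ℝ} (h : IsProb μ) (g : A → C) :
    ∑ y, outProb μ g y = 1 := by
  simpa [h.avg_const] using (avg_comp μ g fun _ => 1).symm

/-- Expand p^s = exp(s log p) to second order. The remainder is uniform in p because p log² p stays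
bounded on [0, 1]. -/
lemma mul_rpow_le {p s : ℝ} (hp : 0 ≤ p) (hp1 : p ≤ 1) (hs : 0 ≤ s) :
    p * p ^ s ≤ p - s * Real.negMulLog p + 2 * s ^ 2 := by
  rcases hp.eq_or_lt with rfl | hp
  · simp; positivity
  have hl : Real.log p ≤ 0 := Real.log_nonpos hp.le hp1
  have hexp : ∀ x : ℝ, x ≤ 0 → Real.exp x ≤ 1 + x + x ^ 2 := by
    intro x hx
    by_cases h : -1 ≤ x
    · have := (abs_le.1 (Real.abs_exp_sub_one_sub_id_le (abs_le.2 ⟨h, by linarith⟩))).2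
      linarith
    -- For x < -1 the right side already exceeds 1.
    · have := Real.exp_le_one_iff.2 hx
      nlinarith
  have h1 := hexp (Real.log p * s) (mul_nonpos_of_nonpos_of_nonneg hl hs)
  rw [← Real.rpow_def_of_pos hp] at h1
  -- From e^t ≥ t²/2 at t = -log p.
  have h2 : p * Real.log p ^ 2 ≤ 2 := by
    have := Real.quadratic_le_exp_of_nonneg (neg_nonneg.2 hl)
    rw [Real.exp_neg, Real.exp_log hp] at this
    have h3 : Real.log p ^ 2 ≤ 2 * p⁻¹ := by nlinarith
    calc p * Real.log p ^ 2 ≤ p * (2 * p⁻¹) := by gcongr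
      _ = 2 := by field_simp
  calc p * p ^ s ≤ p * (1 + Real.log p * s + (Real.log p * s) ^ 2) := by gcongr
    _ = p - s * Real.negMulLog p + s ^ 2 * (p * Real.log p ^ 2) := by
        rw [Real.negMulLog]; ring
    _ ≤ p - s * Real.negMulLog p + s ^ 2 * 2 := by gcongr
    _ = _ := by ring

lemma log_two_mul_entropy [Fintype C] (v : C → ℝ) :
    Real.log 2 * entropy v = ∑ y, Real.negMulLog (v y) := by
  have : Real.log 2 ≠ 0 := (Real.log_pos one_lt_two).ne'
  rw [entropy, Finset.mul_sum]
  exact Finset.sum_congr rfl fun y _ => by field_simp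

lemma rhoSum_le [Fintype C] {μ : A → ℝ} (h : IsProb μ) (g : A → C) {s : ℝ} (hs : 0 ≤ s) :
    rhoSum μ g s ≤
      1 - s * (Real.log 2 * entropy (outProb μ g)) + 2 * s ^ 2 * Fintype.card C := by
  rw [rhoSum, avg_comp μ g fun y => outProb μ g y ^ s]
  refine (Finset.sum_le_sum fun y _ =>
    mul_rpow_le (outProb_nonneg h g y) (outProb_le_one h g y) hs).trans_eq ?_
  rw [Finset.sum_add_distrib, Finset.sum_sub_distrib, sum_outProb h, ← Finset.mul_sum,
    log_two_mul_entropy]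
  simp
  ring

/-- Each term satisfies -p log p ≤ 1 - p ≤ 1. A crude uniform bound suffices: it serves to make sums
over a possibly infinite time-sharing alphabet converge. -/
lemma abs_entropy_outProb_le [Fintype C] {μ : A → ℝ} (h : IsProb μ) (g : A → C) :
    |entropy (outProb μ g)| ≤ Fintype.card C / Real.log 2 := by
  have h2 : 0 < Real.log 2 := Real.log_pos one_lt_two
  have hb : ∀ y, 0 ≤ Real.negMulLog (outProb μ g y) ∧ Real.negMulLog (outProb μ g y) ≤ 1 := by
    intro y
    refine ⟨Real.negMulLog_nonneg (outProb_nonneg h g y) (outProb_le_one h g y), ?_⟩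
    rcases (outProb_nonneg h g y).eq_or_lt with h0 | h0
    · simp [← h0]
    · have := mul_le_mul_of_nonneg_left (Real.one_sub_inv_le_log_of_pos h0) h0.le
      rw [mul_sub, mul_inv_cancel₀ h0.ne'] at this
      rw [Real.negMulLog]
      linarith
  rw [le_div_iff₀ h2]
  rw [← congrArg (|entropy (outProb μ g)| * ·) (abs_of_pos h2), ← abs_mul, mul_comm,
    log_two_mul_entropy, abs_of_nonneg (Finset.sum_nonneg fun y _ => (hb y).1)]
  exact (Finset.sum_le_sum fun y _ => (hb y).2).trans_eq (by simp)

end Letter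

/-! ### Memoryless extension -/

section Tensor

variable {A B C ι : Type*} [Fintype A] [Fintype B] [Fintype ι] [DecidableEq ι]

lemma outProb_pi (μ : ι → A → ℝ) (g : ι → A → C) (y : ι → C) :
    outProb (piWeight μ) (fun x i => g i (x i)) y = ∏ i, outProb (μ i) (g i) (y i) := by
  simp only [outProb, funext_iff, ind_forall]
  exact avg_piWeight_prod μ fun i a => ind (g i a = y i)

lemma outProb_prodWeight (μ : A → ℝ) (ν : B → ℝ) (G : A → B → C) (y : C) :
    outProb (prodWeight μ ν) (fun p => G p.1 p.2) y = avg μ fun a => outProb ν (G a) y := by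
  rw [outProb, avg_prodWeight]
  rfl

lemma outProb_prodWeight_pi (μ : ι → A → ℝ) (ν : ι → B → ℝ) (G : A → B → C) (y : ι → C) :
    outProb (prodWeight (piWeight μ) (piWeight ν)) (fun p i => G (p.1 i) (p.2 i)) y =
      ∏ i, outProb (prodWeight (μ i) (ν i)) (fun p => G p.1 p.2) (y i) := by
  rw [outProb_prodWeight (piWeight μ) (piWeight ν) (fun x₁ x₂ i => G (x₁ i) (x₂ i))]
  simp only [outProb_prodWeight]
  have : ∀ x₁ : ι → A, outProb (piWeight ν) (fun x₂ i => G (x₁ i) (x₂ i)) y =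
      ∏ i, outProb (ν i) (G (x₁ i)) (y i) := fun x₁ => outProb_pi ν (fun i => G (x₁ i)) y
  simp only [this]
  exact avg_piWeight_prod μ fun i a => outProb (ν i) (G a) (y i)

lemma rhoSum_pi {μ : ι → A → ℝ} (h : ∀ i, IsProb (μ i)) (g : ι → A → C) (s : ℝ) :
    rhoSum (piWeight μ) (fun x i => g i (x i)) s = ∏ i, rhoSum (μ i) (g i) s := by
  simp only [rhoSum, outProb_pi]
  simp only [← Real.finsetProd_rpow _ _ fun i _ => outProb_nonneg (h i) (g i) _]
  exact avg_piWeight_prod μ fun i a => outProb (μ i) (g i) (g i a) ^ s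

lemma rhoSum_prodWeight_pi {μ : ι → A → ℝ} {ν : ι → B → ℝ} (hμ : ∀ i, IsProb (μ i))
    (hν : ∀ i, IsProb (ν i)) (G : A → B → C) (s : ℝ) :
    rhoSum (prodWeight (piWeight μ) (piWeight ν)) (fun p i => G (p.1 i) (p.2 i)) s =
      ∏ i, rhoSum (prodWeight (μ i) (ν i)) (fun p => G p.1 p.2) s := by
  simp only [rhoSum, outProb_prodWeight_pi]
  simp only [← Real.finsetProd_rpow _ _ fun i _ =>
    outProb_nonneg ((hμ i).prodWeight (hν i)) (fun p => G p.1 p.2) _]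
  simp only [avg_prodWeight]
  have : ∀ x₁ : ι → A, (avg (piWeight ν) fun x₂ => ∏ i,
      outProb (prodWeight (μ i) (ν i)) (fun p => G p.1 p.2) (G (x₁ i) (x₂ i)) ^ s) =
      ∏ i, avg (ν i) fun b =>
        outProb (prodWeight (μ i) (ν i)) (fun p => G p.1 p.2) (G (x₁ i) b) ^ s := fun x₁ =>
    avg_piWeight_prod ν fun i b =>
      outProb (prodWeight (μ i) (ν i)) (fun p => G p.1 p.2) (G (x₁ i) b) ^ s
  simp only [this]
  exact avg_piWeight_prod μ fun i a => avg (ν i) fun b =>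
      outProb (prodWeight (μ i) (ν i)) (fun p => G p.1 p.2) (G a b) ^ s

lemma avg_rhoSum_pi (μ : ι → A → ℝ) {ν : ι → B → ℝ}
    (hν : ∀ i, IsProb (ν i)) (G : A → B → C) (s : ℝ) :
    (avg (piWeight μ) fun x₁ => rhoSum (piWeight ν) (fun x₂ i => G (x₁ i) (x₂ i)) s) =
      ∏ i, avg (μ i) fun a => rhoSum (ν i) (G a) s := by
  have : ∀ x₁ : ι → A, rhoSum (piWeight ν) (fun x₂ i => G (x₁ i) (x₂ i)) s =
      ∏ i, rhoSum (ν i) (G (x₁ i)) s := fun x₁ => rhoSum_pi hν (fun i => G (x₁ i)) s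
  simp only [this]
  exact avg_piWeight_prod μ fun i a => rhoSum (ν i) (G a) s

/-- Random coding bound over `m` uses of a channel, with letterwise input laws. -/
theorem exists_code_nfold {U m : ℕ} (hU : 0 < U) (G : Channel A B C) {μ : Fin m → A → ℝ}
    {ν : Fin m → B → ℝ} (hμ : ∀ i, IsProb (μ i)) (hν : ∀ i, IsProb (ν i)) {s₀ s₁ s₂ : ℝ}
    (h₀ : 0 < s₀ ∧ s₀ ≤ 1) (h₁ : 0 < s₁ ∧ s₁ ≤ 1) (h₂ : 0 < s₂ ∧ s₂ ≤ 1) :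
    Feasible (((U : ℝ) ^ 2) ^ s₀ * ∏ i, rhoSum (prodWeight (μ i) (ν i)) (fun p => G p.1 p.2) s₀ +
      (U : ℝ) ^ s₁ * ∏ i, (avg (μ i) fun a => rhoSum (ν i) (G a) s₁) +
      (U : ℝ) ^ s₂ * ∏ i, (avg (ν i) fun b => rhoSum (μ i) (fun a => G a b) s₂))
      (identityTarget U) (G.nfold m) := by
  obtain ⟨f₁, f₂, φ, h⟩ := exists_code hU (G.nfold m) (IsProb.piWeight hμ) (IsProb.piWeight hν)
    h₀ h₁ h₂
  refine ⟨f₁, f₂, φ, h.trans_eq ?_⟩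
  rw [← rhoSum_prodWeight_pi hμ hν G, ← avg_rhoSum_pi μ hν G,
    ← avg_rhoSum_pi ν hμ fun b a => G a b]
  simp only [rhoSum, avg_prodWeight]
  rfl

end Tensor

/-! ### Expectations over a discrete law -/

section Expectation

variable {A B C Q Z Y : Type*}

/-- The expectation of `F` under the discrete law `p`. -/
noncomputable def expect (p : PMF Q) (F : Q → ℝ) : ℝ := ∑' q, (p q).toReal * F q

lemma hasSum_toReal (p : PMF Q) : HasSum (fun q => (p q).toReal) 1 := by
  have := (ENNReal.summable_toReal p.tsum_coe_ne_top).hasSum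
  rwa [← ENNReal.tsum_toReal_eq p.apply_ne_top, p.tsum_coe, ENNReal.toReal_one] at this

lemma summable_expect (p : PMF Q) {F : Q → ℝ} {c : ℝ} (hF : ∀ q, |F q| ≤ c) :
    Summable fun q => (p q).toReal * F q := by
  refine Summable.of_norm_bounded ((hasSum_toReal p).summable.mul_right c) fun q => ?_
  rw [norm_mul, Real.norm_eq_abs, Real.norm_eq_abs, abs_of_nonneg ENNReal.toReal_nonneg]
  exact mul_le_mul_of_nonneg_left (hF q) ENNReal.toReal_nonneg

lemma expect_const (p : PMF Q) (c : ℝ) : expect p (fun _ => c) = c := by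
  rw [expect, tsum_mul_right, (hasSum_toReal p).tsum_eq, one_mul]

lemma expect_mono (p : PMF Q) {F F' : Q → ℝ} {c c' : ℝ} (hF : ∀ q, |F q| ≤ c)
    (hF' : ∀ q, |F' q| ≤ c') (h : ∀ q, F q ≤ F' q) : expect p F ≤ expect p F' :=
  (summable_expect p hF).tsum_le_tsum
    (fun q => mul_le_mul_of_nonneg_left (h q) ENNReal.toReal_nonneg) (summable_expect p hF')

lemma exists_le_expect (p : PMF Q) {F : Q → ℝ} {c : ℝ} (hF : ∀ q, |F q| ≤ c) :
    ∃ q, F q ≤ expect p F := by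
  by_contra! h
  obtain ⟨q, hq⟩ := p.support_nonempty
  have hq' : 0 < (p q).toReal := ENNReal.toReal_pos hq (p.apply_ne_top q)
  have : expect p (fun _ => expect p F) < expect p F :=
    (summable_expect p (F := fun _ => expect p F) fun _ => le_rfl).tsum_lt_tsum
      (fun q => mul_le_mul_of_nonneg_left (h q).le ENNReal.toReal_nonneg)
      (mul_lt_mul_of_pos_left (h q) hq') (summable_expect p hF)
  rw [expect_const] at this
  exact lt_irrefl _ this

lemma expect_sum_mul {κ : Type*} [Fintype κ] (p : PMF Q) {F : κ → Q → ℝ} {c : ℝ}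
    (hF : ∀ k q, |F k q| ≤ c) (d : κ → ℝ) :
    expect p (fun q => ∑ k, d k * F k q) = ∑ k, d k * expect p (F k) := by
  simp only [expect, Finset.mul_sum, ← tsum_mul_left]
  rw [Summable.tsum_finsetSum fun k _ => ?_]
  · exact Finset.sum_congr rfl fun k _ => tsum_congr fun q => by ring
  · exact ((summable_expect p (hF k)).mul_left (d k)).congr fun q => by ring

/-- A time-sharing sequence can be chosen so that finitely many product functionals are
simultaneously no larger, in weighted sum, than their averages. -/
lemma exists_timeSharing {κ : Type*} [Fintype κ] (p : PMF Q) {F : κ → Q → ℝ} {c : ℝ}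
    (hF : ∀ k q, |F k q| ≤ c) (m : ℕ) (d : κ → ℝ) :
    ∃ q : Fin m → Q, ∑ k, d k * ∏ i, F k (q i) ≤ ∑ k, d k * expect p (F k) ^ m := by
  induction m generalizing d with
  | zero => exact ⟨Fin.elim0, by simp⟩
  | succ m ih =>
    have hb : ∀ q, |∑ k, (d k * expect p (F k) ^ m) * F k q| ≤
        ∑ k, |d k * expect p (F k) ^ m| * c := fun q =>
      (Finset.abs_sum_le_sum_abs _ _).trans <| Finset.sum_le_sum fun k _ => by
        rw [abs_mul]
        exact mul_le_mul_of_nonneg_left (hF k q) (abs_nonneg _)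
    -- The first letter is chosen as if the remaining `m` letters already attained their means. Its
    -- values are then absorbed into the coefficients, which is why the induction generalizes `d`.
    obtain ⟨q₀, hq₀⟩ := exists_le_expect p hb
    rw [expect_sum_mul p hF] at hq₀
    obtain ⟨q, hq⟩ := ih fun k => d k * F k q₀
    refine ⟨Fin.cons q₀ q, ?_⟩
    simp only [Fin.prod_univ_succ, Fin.cons_zero, Fin.cons_succ, ← mul_assoc]
    refine hq.trans (le_trans (Finset.sum_le_sum fun k _ => le_of_eq ?_)
      (hq₀.trans (Finset.sum_le_sum fun k _ => le_of_eq ?_))) <;> ring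

/-- The probability vector of a `PMF`. -/
noncomputable def weight (p : PMF A) (a : A) : ℝ := (p a).toReal

lemma isProb_weight [Fintype A] (p : PMF A) : IsProb (weight p) where
  nonneg _ := ENNReal.toReal_nonneg
  sum_eq_one := (hasSum_fintype _).unique (hasSum_toReal p)

lemma weight_map [Fintype A] (p : PMF A) (g : A → C) : weight (p.map g) = outProb (weight p) g := by
  classical
  funext y
  rw [weight, PMF.map_apply, tsum_fintype, ENNReal.toReal_sum]
  · refine Finset.sum_congr rfl fun a _ => ?_
    by_cases h : g a = y
    · simp [h, ind, weight]
    · simp [h, ind, Ne.symm h]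
  · intro a _
    split_ifs
    exacts [p.apply_ne_top a, ENNReal.zero_ne_top]

lemma bind_map_mk_apply (p : PMF Z) (κ : Z → PMF Y) (z : Z) (y : Y) :
    (p.bind fun z => (κ z).map (Prod.mk z)) (z, y) = p z * κ z y := by
  classical
  rw [PMF.bind_apply, tsum_eq_single z]
  · rw [PMF.map_apply, tsum_eq_single y]
    · simp
    · intro y' hy
      simp [Ne.symm hy]
  · intro z' hz
    rw [PMF.map_apply]
    simp [Ne.symm hz]

lemma bind_map_mk_right_apply (p : PMF Z) (κ : Z → PMF Y) (z : Z) (y : Y) :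
    (p.bind fun z => (κ z).map fun y => (y, z)) (y, z) = p z * κ z y := by
  classical
  rw [PMF.bind_apply, tsum_eq_single z]
  · rw [PMF.map_apply, tsum_eq_single y]
    · simp
    · intro y' hy
      simp [Ne.symm hy]
  · intro z' hz
    rw [PMF.map_apply]
    simp [Ne.symm hz]

lemma expect_bind_map [Fintype A] (p : PMF Q) (κ : Q → PMF A) {F : A × Q → ℝ} {c : ℝ}
    (hF : ∀ z, |F z| ≤ c) :
    expect (p.bind fun q => (κ q).map fun a => (a, q)) F =
      expect p fun q => avg (weight (κ q)) fun a => F (a, q) := by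
  have hs := summable_expect (p.bind fun q => (κ q).map fun a => (a, q)) hF
  rw [expect, ← (Equiv.prodComm Q A).tsum_eq]
  refine ((Equiv.prodComm Q A).summable_iff.2 hs).tsum_prod.trans ?_
  refine tsum_congr fun q => ?_
  simp only [Function.comp_apply, Equiv.prodComm_apply, Prod.swap_prod_mk, bind_map_mk_right_apply,
    ENNReal.toReal_mul, tsum_fintype, avg, Finset.mul_sum, weight, mul_assoc]

/-- Dividing the joint law by its first marginal recovers the kernel wherever `p` has mass;
elsewhere the term has weight zero. -/
lemma condEntropy_bind [Fintype Y] (p : PMF Z) (κ : Z → PMF Y) :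
    condEntropy (p.bind fun z => (κ z).map (Prod.mk z)) =
      expect p fun z => entropy (weight (κ z)) := by
  have hfst : (p.bind fun z => (κ z).map (Prod.mk z)).map Prod.fst = p := by
    rw [PMF.map_bind]
    have : ∀ z, ((κ z).map (Prod.mk z)).map Prod.fst = PMF.pure z := fun z => by
      rw [PMF.map_comp]
      exact PMF.map_const _ _
    simp only [this, PMF.bind_pure]
  rw [condEntropy, hfst]
  refine tsum_congr fun z => ?_
  simp only [bind_map_mk_apply, ENNReal.toReal_mul]
  by_cases h : (p z).toReal = 0
  · simp [h]
  · simp only [mul_div_cancel_left₀ _ h]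
    rfl

variable {X₁ X₂ : Type*} [Fintype X₁] [Fintype X₂] [Fintype Y]

lemma entropyYGivenQ_eq (pQ : PMF Q) (p₁ : Q → PMF X₁) (p₂ : Q → PMF X₂) (G : Channel X₁ X₂ Y) :
    entropyYGivenQ (jointLaw pQ p₁ p₂ G) = expect pQ fun q =>
      entropy (outProb (prodWeight (weight (p₁ q)) (weight (p₂ q))) fun x => G x.1 x.2) := by
  have h : (jointLaw pQ p₁ p₂ G).map (fun t => (t.1, t.2.2.2)) = pQ.bind fun q =>
      (((p₁ q).bind fun a => (p₂ q).map (Prod.mk a)).map fun x => G x.1 x.2).map (Prod.mk q) := by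
    simp only [jointLaw, PMF.map_bind, PMF.pure_map, PMF.map_comp]
    rfl
  rw [entropyYGivenQ, h, condEntropy_bind]
  congr 1
  funext q
  rw [weight_map]
  congr 2
  funext x
  exact (congrArg ENNReal.toReal (bind_map_mk_apply _ _ x.1 x.2)).trans ENNReal.toReal_mul

lemma entropyYGivenX₁Q_eq (pQ : PMF Q) (p₁ : Q → PMF X₁) (p₂ : Q → PMF X₂)
    (G : Channel X₁ X₂ Y) :
    entropyYGivenX₁Q (jointLaw pQ p₁ p₂ G) = expect pQ fun q =>
      avg (weight (p₁ q)) fun a => entropy (outProb (weight (p₂ q)) (G a)) := by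
  have h : (jointLaw pQ p₁ p₂ G).map (fun t => ((t.2.1, t.1), t.2.2.2)) =
      (pQ.bind fun q => (p₁ q).map fun a => (a, q)).bind fun z =>
        ((p₂ z.2).map (G z.1)).map (Prod.mk z) := by
    simp only [jointLaw, PMF.map_bind, PMF.pure_map, PMF.map_comp, PMF.bind_bind, PMF.bind_map]
    rfl
  rw [entropyYGivenX₁Q, h, condEntropy_bind]
  simp only [weight_map]
  exact expect_bind_map pQ p₁ fun z => abs_entropy_outProb_le (isProb_weight _) _

lemma entropyYGivenX₂Q_eq (pQ : PMF Q) (p₁ : Q → PMF X₁) (p₂ : Q → PMF X₂)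
    (G : Channel X₁ X₂ Y) :
    entropyYGivenX₂Q (jointLaw pQ p₁ p₂ G) = expect pQ fun q =>
      avg (weight (p₂ q)) fun b => entropy (outProb (weight (p₁ q)) fun a => G a b) := by
  have h : (jointLaw pQ p₁ p₂ G).map (fun t => ((t.2.2.1, t.1), t.2.2.2)) =
      (pQ.bind fun q => (p₂ q).map fun b => (b, q)).bind fun z =>
        ((p₁ z.2).map fun a => G a z.1).map (Prod.mk z) := by
    -- Given `q` the inputs are independent, so the second can be drawn first and grouped with `q`.
    have hc : ∀ q, ((p₁ q).bind fun a => (p₂ q).bind fun b => PMF.pure (q, a, b, G a b)) =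
        (p₂ q).bind fun b => (p₁ q).bind fun a => PMF.pure (q, a, b, G a b) := fun q =>
      PMF.bind_comm _ _ _
    simp only [jointLaw, hc]
    simp only [PMF.map_bind, PMF.pure_map, PMF.map_comp, PMF.bind_bind, PMF.bind_map]
    rfl
  rw [entropyYGivenX₂Q, h, condEntropy_bind]
  simp only [weight_map]
  exact expect_bind_map pQ p₂ fun z => abs_entropy_outProb_le (isProb_weight _) _

/-- Exponential bound on an average of `S` from a second-order bound in terms of the entropy. -/
lemma expect_le_exp (p : PMF Q) {S E : Q → ℝ} {s K c : ℝ} (hS : ∀ q, |S q| ≤ 1)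
    (hE : ∀ q, |E q| ≤ c) (h : ∀ q, S q ≤ 1 - s * (Real.log 2 * E q) + s ^ 2 * K) :
    expect p S ≤ Real.exp (-(s * (Real.log 2 * expect p E - s * K))) := by
  -- The second-order bound is affine in `E`, hence a combination of these two functions; after
  -- averaging, 1 + x ≤ e^x finishes.
  have hc : ∀ (i : Fin 2) q, |(![fun _ => 1, E] : Fin 2 → Q → ℝ) i q| ≤ max 1 c := by
    intro i q
    fin_cases i
    · simp
    · simpa using Or.inr (hE q)
  have hlin := expect_sum_mul p hc ![1 + s ^ 2 * K, -(s * Real.log 2)]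
  simp only [Fin.sum_univ_two, Matrix.cons_val_zero, Matrix.cons_val_one, expect_const] at hlin
  have hb : ∀ q, |(1 + s ^ 2 * K) * 1 + -(s * Real.log 2) * E q| ≤
      |(1 + s ^ 2 * K) * 1| + |-(s * Real.log 2)| * c := fun q => by
    refine (abs_add_le _ _).trans ?_
    rw [abs_mul (-(s * Real.log 2))]
    gcongr
    exact hE q
  have := expect_mono p hS hb fun q => (h q).trans_eq (by ring)
  rw [hlin] at this
  refine this.trans (le_trans (le_of_eq ?_) (Real.add_one_le_exp _))
  ring

end Expectation

/-! ### Asymptotics -/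

/-- The strict inequality leaves a gap b - a in the exponent. Half of it pays for the second-order
loss `s * K`, the other half leaves the decay U^(-s(b-a)/2). The exponent `s` depends on neither `ε`
nor `U`. -/
lemma exists_exponent {a H K : ℝ} {n : ℕ → ℕ} (ha : 0 < a) (hK : 0 ≤ K)
    (h : PowDotLT a fun U => (2 : ℝ) ^ ((n U : ℝ) * H)) :
    ∃ s : ℝ, (0 < s ∧ s ≤ 1) ∧ ∀ ε > 0, ∀ᶠ U : ℕ in Filter.atTop,
      ((U : ℝ) ^ a) ^ s * Real.exp (-(s * (Real.log 2 * H - s * K))) ^ n U ≤ ε := by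
  obtain ⟨b, hab, hb⟩ := EReal.lt_iff_exists_real_btwn.1 h
  have hab' : a < b := EReal.coe_lt_coe_iff.1 hab
  have hb0 : 0 < b := ha.trans hab'
  have hl2 : 0 < Real.log 2 := Real.log_pos one_lt_two
  have hev : ∀ᶠ U : ℕ in Filter.atTop, b * Real.log U < n U * (Real.log 2 * H) := by
    filter_upwards [Filter.eventually_lt_of_lt_liminf hb, Filter.eventually_ge_atTop 2] with U hU h2
    have hlU : 0 < Real.log U := Real.log_pos (by exact_mod_cast h2)
    rw [EReal.coe_lt_coe_iff, Real.logb_rpow two_pos (by norm_num), Real.logb, div_div_eq_mul_div,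
      lt_div_iff₀ hlU] at hU
    linarith
  -- If `H ≤ 0`, then n H ln 2 could never exceed the positive b ln U.
  have hH : 0 < Real.log 2 * H := by
    obtain ⟨U, hU, h2⟩ := (hev.and (Filter.eventually_ge_atTop 2)).exists
    have hlU : 0 < Real.log U := Real.log_pos (by exact_mod_cast h2)
    by_contra! hneg
    have := mul_nonpos_of_nonneg_of_nonpos (Nat.cast_nonneg (α := ℝ) (n U)) hneg
    have := mul_pos hb0 hlU
    linarith
  -- Chosen so that `t * b` is the midpoint of `a` and `b`.
  set t := (a + b) / (2 * b) with ht
  have ht0 : 0 < t := by positivity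
  have ht1 : t < 1 := by rw [ht, div_lt_one (by positivity)]; linarith
  have htb : t * b = (a + b) / 2 := by rw [ht]; field_simp
  set h' := Real.log 2 * H with hh'
  -- Small enough that the loss `s * K` is at most `(1 - t) * h'`; `K + 1` avoids division by zero.
  set s := min 1 (h' * (1 - t) / (K + 1)) with hs
  have hs0 : 0 < s := lt_min one_pos (by have := sub_pos.2 ht1; positivity)
  have hsK : t * h' ≤ h' - s * K := by
    have h1 : s * (K + 1) ≤ h' * (1 - t) :=
      (le_div_iff₀ (by positivity)).1 (min_le_right _ _)
    nlinarith
  refine ⟨s, ⟨hs0, min_le_left _ _⟩, fun ε hε => ?_⟩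
  have hlim : Filter.Tendsto (fun U : ℕ => Real.exp (-(s * ((b - a) / 2) * Real.log U)))
      Filter.atTop (nhds 0) :=
    Real.tendsto_exp_neg_atTop_nhds_zero.comp <|
      (Real.tendsto_log_atTop.comp tendsto_natCast_atTop_atTop).const_mul_atTop
        (mul_pos hs0 (by linarith))
  filter_upwards [hev, Filter.eventually_ge_atTop 2, hlim.eventually_le_const hε] with U hU h2 hle
  refine le_trans ?_ hle
  have hU0 : (0 : ℝ) < U := by positivity
  rw [← Real.rpow_mul hU0.le, Real.rpow_def_of_pos hU0, ← Real.exp_nat_mul, ← Real.exp_add,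
    Real.exp_le_exp]
  have h1 : t * (b * Real.log U) ≤ n U * (h' - s * K) :=
    calc t * (b * Real.log U) ≤ t * (n U * h') := by gcongr
      _ = n U * (t * h') := by ring
      _ ≤ _ := by gcongr
  have h3 := mul_le_mul_of_nonneg_left h1 hs0.le
  rw [← mul_assoc t, htb] at h3
  linarith

end MACComputation

/-! ### Combining the three exponents. -/

open MACComputation in
theorem theorem3 (δ : ℝ) (hδ : 0 < δ) (X Y : ℕ) (G : Channel (Fin X) (Fin X) (Fin Y))
    {Q : Type*} (pQ : PMF Q) (p₁ p₂ : Q → PMF (Fin X)) (n : ℕ → ℕ)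
    (h₀ : PowDotLT 2 fun U =>
      (2 : ℝ) ^ ((n U : ℝ) * entropyYGivenQ (jointLaw pQ p₁ p₂ G)))
    (h₁ : PowDotLT 1 fun U =>
      (2 : ℝ) ^ ((n U : ℝ) * entropyYGivenX₁Q (jointLaw pQ p₁ p₂ G)))
    (h₂ : PowDotLT 1 fun U =>
      (2 : ℝ) ^ ((n U : ℝ) * entropyYGivenX₂Q (jointLaw pQ p₁ p₂ G))) :
    ∀ᶠ U : ℕ in Filter.atTop, Feasible δ (identityTarget U) (G.nfold (n U)) := by
  rw [entropyYGivenQ_eq] at h₀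
  rw [entropyYGivenX₁Q_eq] at h₁
  rw [entropyYGivenX₂Q_eq] at h₂
  have hK : (0 : ℝ) ≤ 2 * Y := by positivity
  obtain ⟨s₀, hs₀, H₀⟩ := exists_exponent two_pos hK h₀
  obtain ⟨s₁, hs₁, H₁⟩ := exists_exponent one_pos hK h₁
  obtain ⟨s₂, hs₂, H₂⟩ := exists_exponent one_pos hK h₂
  have hw₁ : ∀ q, IsProb (weight (p₁ q)) := fun q => isProb_weight _
  have hw₂ : ∀ q, IsProb (weight (p₂ q)) := fun q => isProb_weight _
  set S₀ : Q → ℝ := fun q =>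
    rhoSum (prodWeight (weight (p₁ q)) (weight (p₂ q))) (fun x => G x.1 x.2) s₀ with hS₀
  set S₁ : Q → ℝ := fun q => avg (weight (p₁ q)) fun a => rhoSum (weight (p₂ q)) (G a) s₁ with hS₁
  set S₂ : Q → ℝ := fun q =>
    avg (weight (p₂ q)) fun b => rhoSum (weight (p₁ q)) (fun a => G a b) s₂ with hS₂
  have b₀ : ∀ q, 0 ≤ S₀ q ∧ S₀ q ≤ 1 := fun q =>
    ⟨rhoSum_nonneg ((hw₁ q).prodWeight (hw₂ q)) _ _,
      rhoSum_le_one ((hw₁ q).prodWeight (hw₂ q)) _ hs₀.1.le⟩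
  have b₁ : ∀ q, 0 ≤ S₁ q ∧ S₁ q ≤ 1 := fun q =>
    ⟨(hw₁ q).avg_nonneg fun _ => rhoSum_nonneg (hw₂ q) _ _,
      (hw₁ q).avg_le fun _ => rhoSum_le_one (hw₂ q) _ hs₁.1.le⟩
  have b₂ : ∀ q, 0 ≤ S₂ q ∧ S₂ q ≤ 1 := fun q =>
    ⟨(hw₂ q).avg_nonneg fun _ => rhoSum_nonneg (hw₁ q) _ _,
      (hw₂ q).avg_le fun _ => rhoSum_le_one (hw₁ q) _ hs₂.1.le⟩
  have toAbs : ∀ {x : ℝ}, 0 ≤ x ∧ x ≤ 1 → |x| ≤ 1 := fun h =>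
    (abs_of_nonneg h.1).trans_le h.2
  have avg_bound : ∀ {μ : Fin X → ℝ} (_ : IsProb μ) {ν : Fin X → ℝ} (_ : IsProb ν)
      (g : Fin X → Fin X → Fin Y) {s : ℝ}, 0 ≤ s → (avg μ fun a => rhoSum ν (g a) s) ≤
        1 - s * (Real.log 2 * avg μ fun a => entropy (outProb ν (g a))) + s ^ 2 * (2 * Y) := by
    intro μ hμ ν hν g s hs
    refine (hμ.avg_mono fun a => rhoSum_le hν (g a) hs).trans_eq ?_
    have : ∀ a, 1 - s * (Real.log 2 * entropy (outProb ν (g a))) +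
        2 * s ^ 2 * (Fintype.card (Fin Y) : ℝ) =
        (1 + s ^ 2 * (2 * Y)) + -(s * Real.log 2) * entropy (outProb ν (g a)) := fun a => by
      rw [Fintype.card_fin]; ring
    simp only [this]
    rw [avg_add, avg_mul_left, hμ.avg_const]
    ring
  have abs_avg : ∀ {μ : Fin X → ℝ} (_ : IsProb μ) {ν : Fin X → ℝ} (_ : IsProb ν)
      (g : Fin X → Fin X → Fin Y), |avg μ fun a => entropy (outProb ν (g a))| ≤
        Fintype.card (Fin Y) / Real.log 2 := by
    intro μ hμ ν hν g
    have hb := fun a => abs_le.1 (abs_entropy_outProb_le hν (g a))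
    refine abs_le.2 ⟨?_, hμ.avg_le fun a => (hb a).2⟩
    exact (hμ.avg_const _).symm.trans_le (hμ.avg_mono fun a => (hb a).1)
  have e₀ := expect_le_exp pQ (K := 2 * Y) (s := s₀) (fun q => toAbs (b₀ q))
    (fun q => abs_entropy_outProb_le ((hw₁ q).prodWeight (hw₂ q)) fun x => G x.1 x.2)
    fun q => (rhoSum_le ((hw₁ q).prodWeight (hw₂ q)) _ hs₀.1.le).trans_eq (by
      rw [Fintype.card_fin]; ring)
  have e₁ := expect_le_exp pQ (K := 2 * Y) (s := s₁) (fun q => toAbs (b₁ q))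
    (fun q => abs_avg (hw₁ q) (hw₂ q) G) fun q => avg_bound (hw₁ q) (hw₂ q) G hs₁.1.le
  have e₂ := expect_le_exp pQ (K := 2 * Y) (s := s₂) (fun q => toAbs (b₂ q))
    (fun q => abs_avg (hw₂ q) (hw₁ q) fun b a => G a b)
    fun q => avg_bound (hw₂ q) (hw₁ q) (fun b a => G a b) hs₂.1.le
  have hδ3 : 0 < δ / 3 := by positivity
  filter_upwards [H₀ _ hδ3, H₁ _ hδ3, H₂ _ hδ3, Filter.eventually_gt_atTop 0] with U k₀ k₁ k₂ hU
  have hS : ∀ (k : Fin 3) q, |(![S₀, S₁, S₂] : Fin 3 → Q → ℝ) k q| ≤ 1 := by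
    intro k q
    fin_cases k
    exacts [toAbs (b₀ q), toAbs (b₁ q), toAbs (b₂ q)]
  -- The same sequence must serve all three error terms, so their sum, with its powers of `U` as
  -- weights, is minimized jointly against its mean.
  obtain ⟨q, hq⟩ := exists_timeSharing pQ hS (n U)
    ![((U : ℝ) ^ 2) ^ s₀, (U : ℝ) ^ s₁, (U : ℝ) ^ s₂]
  simp only [Fin.sum_univ_three, Matrix.cons_val_zero, Matrix.cons_val_one, Matrix.cons_val] at hq
  obtain ⟨f₁, f₂, φ, hφ⟩ := exists_code_nfold hU G (fun i => hw₁ (q i)) (fun i => hw₂ (q i))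
    hs₀ hs₁ hs₂
  refine ⟨f₁, f₂, φ, hφ.trans (hq.trans ?_)⟩
  rw [Real.rpow_two] at k₀
  rw [Real.rpow_one] at k₁ k₂
  have nonneg : ∀ {S : Q → ℝ}, (∀ q, 0 ≤ S q ∧ S q ≤ 1) → 0 ≤ expect pQ S := fun h =>
    tsum_nonneg fun q => mul_nonneg ENNReal.toReal_nonneg (h q).1
  have m₀ : ((U : ℝ) ^ 2) ^ s₀ * expect pQ S₀ ^ n U ≤ δ / 3 :=
    le_trans (by gcongr; exact nonneg b₀) k₀
  have m₁ : (U : ℝ) ^ s₁ * expect pQ S₁ ^ n U ≤ δ / 3 := le_trans (by gcongr; exact nonneg b₁) k₁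
  have m₂ : (U : ℝ) ^ s₂ * expect pQ S₂ ^ n U ≤ δ / 3 := le_trans (by gcongr; exact nonneg b₂) k₂
  linarith
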